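/- Let $\Sigma=\{a,b\}$ be a two-letter alphabet, let $w\in\Sigma^*$ be a word of length $|w|=n$, and let $L=\Sigma^*w\Sigma^*$. The syntactic congruence of $L$ is defined on $\Sigma^*$ by $u\approx_L v$ if and only if, for all $x,y\in\Sigma^*$, $xuy\in L\Leftrightarrow xvy\in L$. The syntactic complexity $\sigma(L)$ is the cardinality of the syntactic semigroup $\Sigma^+/{\approx_L}$, where $\Sigma^+$ is the set of nonempty words. A word $u\in\Sigma^+$ is an inner factor of $w$ if $w=tus$ for some $t,s\in\Sigma^+$; let $N(w)$ be the number of distinct inner factors of $w$. (i) If $w\notin\{a^{n-1}b,\ ab^{n-1},\ ba^{n-1},\ b^{n-1}a\}$, then $\sigma(L)=n^2+1+N(w)$. (The empty word, $n=0$, is not excluded.) (ii) If $n\ge 2$ and $w\in\{a^{n-1}b,\ ab^{n-1},\ ba^{n-1},\ b^{n-1}a\}$, then $\sigma(L)=n^2$. -/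

import Mathlib

/-- The principal ideal language `Σ* w Σ*` over the alphabet `A`. -/
def principalIdealLanguage {A : Type*} (w : List A) : Language A :=
  {u | ∃ x y : List A, u = x ++ w ++ y}

/-- The syntactic (Myhill) congruence of a language `L` on the free monoid `Σ*`:
`u ≈ v` iff for all words `x, y` one has `x u y ∈ L ↔ x v y ∈ L`. -/
def syntacticCon {A : Type*} (L : Language A) : Con (FreeMonoid A) where
  r u v := ∀ x y : FreeMonoid A,
    FreeMonoid.toList (x * u * y) ∈ L ↔ FreeMonoid.toList (x * v * y) ∈ L
  iseqv := ⟨fun _ _ _ => Iff.rfl, fun h x y => (h x y).symm,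
    fun h h' x y => (h x y).trans (h' x y)⟩
  mul' := by
    intro u v s t h h' x y
    have h1 := h x (s * y)
    have h2 := h' (x * v) y
    simp only [mul_assoc] at h1 h2 ⊢
    exact h1.trans h2

/-- The free semigroup `Σ⁺` of nonempty words, inside the free monoid `Σ*`. -/
def nonemptyWords (A : Type*) : Subsemigroup (FreeMonoid A) where
  carrier := {u | u ≠ 1}
  mul_mem' := by
    intro u v hu _ h
    exact hu (List.append_eq_nil_iff.mp h).1

/-- The syntactic semigroup `Σ⁺ / ≈_L`. -/
abbrev SyntacticSemigroup {A : Type*} (L : Language A) : Type _ :=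
  (Con.comap (MulMemClass.subtype (nonemptyWords A)) (fun u v => map_mul _ u v)
    (syntacticCon L)).Quotient

/-- The syntactic complexity `σ(L)`: the cardinality of the syntactic semigroup
(finite for regular `L`). -/
noncomputable def syntacticComplexity {A : Type*} (L : Language A) : ℕ :=
  Nat.card (SyntacticSemigroup L)

/-- `u` is an inner factor of `w`: `u` is nonempty and `w = t u s` with `t, s` nonempty. -/
def IsInnerFactor {A : Type*} (u w : List A) : Prop :=
  u ≠ [] ∧ ∃ t s : List A, t ≠ [] ∧ s ≠ [] ∧ w = t ++ u ++ s

theorem finite_innerFactors {A : Type*} (w : List A) :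
    {u : List A | IsInnerFactor u w}.Finite := by
  refine (List.finite_toSet w.sublists).subset ?_
  rintro u ⟨_, t, s, _, _, rfl⟩
  exact List.mem_sublists.mpr
    ((List.sublist_append_right t u).trans (List.sublist_append_left (t ++ u) s))

/-- `N(w)`: the number of distinct inner factors of `w`. -/
noncomputable def numInnerFactors {A : Type*} (w : List A) : ℕ :=
  {u : List A | IsInnerFactor u w}.ncard

/-- The set `{a^{n-1} b, a b^{n-1}, b a^{n-1}, b^{n-1} a}` (used for words of length `n`). -/
def exceptionalWords {A : Type*} (a b : A) (n : ℕ) : Set (List A) :=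
  {List.replicate (n - 1) a ++ [b], [a] ++ List.replicate (n - 1) b,
    [b] ++ List.replicate (n - 1) a, List.replicate (n - 1) b ++ [a]}

/-! Nonempty words `u` fall into three kinds. Those containing `w` form one class. An inner factor
of `w` forms a class by itself: a context completing it to exactly `w` leaves no room for another
word. For any other `u`, an occurrence of `w` in `xuy` not inside `u` meets at most one of `x` and
`y`, so the class is determined by the longest prefix of `u` that is a suffix of `w` and the longest
suffix of `u` that is a prefix of `w` (`infix_append_append_iff`); conversely the class determines
both (`IdealEquiv.length_overlap_le`). Hence σ is 1 + N(w) plus the number of realized pairs of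
overlaps, which lie among the n² pairs of a proper suffix and a proper prefix of `w`.

A pair `(s, p)` is realized by `s z p` for a long separator `z` that avoids `w` and adds nothing to
the overlaps (`exists_word_of_overlaps`). Such a `z` exists for every nonempty non-exceptional `w`.
For `w = a^m b` with m ≥ 1, exactly the m pairs `(ε, a^k)` with `k < m` fail, while N(w) = m - 1, so
the total is (m + 1)². Reversal and exchange of letters give the other exceptional words. -/

section

open List

variable {A : Type*}

/-! ### The longest overlap of two words -/

open Classical in
/-- The longest prefix of `u` that is a suffix of `v`. -/
noncomputable def overlap (u v : List A) : List A :=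
  u.take (Nat.findGreatest (fun k => u.take k <:+ v) u.length)

theorem overlap_prefix (u v : List A) : overlap u v <+: u := take_prefix _ _

theorem overlap_suffix (u v : List A) : overlap u v <:+ v := by
  classical
  have h := Nat.findGreatest_spec (P := fun k => u.take k <:+ v) (Nat.zero_le u.length)
    (by simp)
  simpa only [overlap] using h

theorem length_le_length_overlap {u v t : List A} (hu : t <+: u) (hv : t <:+ v) :
    t.length ≤ (overlap u v).length := by
  classical
  have hle := hu.length_le
  have h : t.length ≤ Nat.findGreatest (fun k => u.take k <:+ v) u.length := by
    apply Nat.le_findGreatest hle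
    rwa [← prefix_iff_eq_take.mp hu]
  simp only [overlap, length_take]
  exact le_min h hle

theorem prefix_overlap {u v t : List A} (hu : t <+: u) (hv : t <:+ v) : t <+: overlap u v :=
  prefix_of_prefix_length_le hu (overlap_prefix u v) (length_le_length_overlap hu hv)

theorem overlap_eq {u v s : List A} (hu : s <+: u) (hv : s <:+ v)
    (h : ∀ t, t <+: u → t <:+ v → t.length ≤ s.length) : overlap u v = s :=
  ((prefix_overlap hu hv).eq_of_length_le
    (h _ (overlap_prefix u v) (overlap_suffix u v))).symm

/-- Reversal exchanges prefixes and suffixes, hence the two arguments; facts about right overlaps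
follow from those about left overlaps. -/
theorem overlap_reverse (u v : List A) :
    overlap u.reverse v.reverse = (overlap v u).reverse := by
  apply overlap_eq
  · exact reverse_prefix.mpr (overlap_suffix v u)
  · exact reverse_suffix.mpr (overlap_prefix v u)
  · intro t hu hv
    have := length_le_length_overlap (u := v) (v := u) (t := t.reverse)
      (by rw [← reverse_suffix]; simpa using hv) (by rw [← reverse_prefix]; simpa using hu)
    simpa using this

/-! ### Occurrences of a word in a product -/

/-- An occurrence starting in `x` and reaching into `u` covers a prefix of `u` that is a suffix of
`w`, hence a prefix of the overlap. -/
theorem infix_append_cases_left {w x u : List A} (h : w <:+: x ++ u) :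
    w <:+: u ∨ w <:+: x ++ overlap u w := by
  obtain ⟨α, β, h⟩ := h
  rw [append_assoc, append_eq_append_iff] at h
  rcases h with ⟨t, rfl, h⟩ | ⟨t, rfl, rfl⟩
  · rw [append_eq_append_iff] at h
    rcases h with ⟨q, rfl, rfl⟩ | ⟨q, rfl, rfl⟩
    · exact .inr ⟨α, q ++ overlap u w, by simp⟩
    · right
      obtain ⟨r, hr⟩ := prefix_overlap (u := q ++ β) (v := t ++ q) (prefix_append q β)
        (suffix_append t q)
      exact ⟨α, r, by simp [← hr]⟩
  · exact .inl ⟨t, β, by simp⟩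

theorem infix_append_cases_right {w u y : List A} (h : w <:+: u ++ y) :
    w <:+: u ∨ w <:+: overlap w u ++ y := by
  have h' : w.reverse <:+: y.reverse ++ u.reverse := by
    rw [← reverse_append]; exact reverse_infix.mpr h
  rcases infix_append_cases_left h' with h | h
  · exact .inl (reverse_infix.mp h)
  · rw [overlap_reverse, ← reverse_append] at h
    exact .inr (reverse_infix.mp h)

theorem infix_append_append_cases {w x u y : List A} (h : w <:+: x ++ u ++ y) :
    w <:+: x ++ u ∨ w <:+: u ++ y ∨
      ∃ t s : List A, t ≠ [] ∧ s ≠ [] ∧ w = t ++ u ++ s := by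
  obtain ⟨α, β, h⟩ := h
  rw [append_assoc, append_assoc, append_eq_append_iff] at h
  rcases h with ⟨t, rfl, h⟩ | ⟨t, rfl, h⟩
  · rw [← append_assoc, append_eq_append_iff] at h
    rcases h with ⟨q, h, rfl⟩ | ⟨q, rfl, rfl⟩
    · exact .inl ⟨α, q, by simp [← h]⟩
    · by_cases ht : t = []
      · exact .inr (.inl ⟨[], β, by simp [ht]⟩)
      by_cases hq : q = []
      · exact .inl ⟨α, [], by simp [hq]⟩
      exact .inr (.inr ⟨t, q, ht, hq, rfl⟩)
  · exact .inr (.inl ⟨t, β, by simp [h]⟩)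

theorem infix_append_append_iff {w u : List A} (hw : ¬ w <:+: u)
    (hu : ¬ ∃ t s : List A, t ≠ [] ∧ s ≠ [] ∧ w = t ++ u ++ s) (x y : List A) :
    w <:+: x ++ u ++ y ↔ w <:+: x ++ overlap u w ∨ w <:+: overlap w u ++ y := by
  constructor
  · intro h
    rcases infix_append_append_cases h with h | h | h
    · exact .inl ((infix_append_cases_left h).resolve_left hw)
    · exact .inr ((infix_append_cases_right h).resolve_left hw)
    · exact absurd h hu
  · obtain ⟨r, hr⟩ := overlap_prefix u w
    obtain ⟨q, hq⟩ := overlap_suffix w u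
    rintro (h | h)
    · exact h.trans ⟨[], r ++ y, by rw [nil_append, append_assoc, append_assoc,
        ← append_assoc (overlap u w), hr]⟩
    · exact h.trans ⟨x ++ q, [], by rw [append_nil, append_assoc, ← append_assoc q, hq,
        append_assoc]⟩

/-! ### Classification of the syntactic classes -/

/-- Two words are syntactically equivalent for the ideal generated by `w`. -/
def IdealEquiv (w u v : List A) : Prop :=
  ∀ x y : List A, w <:+: x ++ u ++ y ↔ w <:+: x ++ v ++ y

theorem IdealEquiv.symm {w u v : List A} (h : IdealEquiv w u v) : IdealEquiv w v u :=
  fun x y => (h x y).symm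

theorem IdealEquiv.infix_iff {w u v : List A} (h : IdealEquiv w u v) :
    w <:+: u ↔ w <:+: v := by
  simpa using h [] []

theorem IdealEquiv.reverse {w u v : List A} (h : IdealEquiv w u v) :
    IdealEquiv w.reverse u.reverse v.reverse := by
  intro x y
  have := h y.reverse x.reverse
  rw [← reverse_infix, ← reverse_infix (l₂ := _ ++ v ++ _)] at this
  simpa using this

/-- The left context `t` with `w = t ++ overlap u w` produces `w` in `t ++ u`, hence in `t ++ v`. So
`w` fits into `t ++ overlap v w`, and lengths compare. -/
theorem IdealEquiv.length_overlap_le {w u v : List A} (h : IdealEquiv w u v)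
    (hv : ¬ w <:+: v) : (overlap u w).length ≤ (overlap v w).length := by
  obtain ⟨t, ht⟩ := overlap_suffix u w
  obtain ⟨r, hr⟩ := overlap_prefix u w
  have h1 : w <:+: t ++ u ++ [] :=
    ⟨[], r, by rw [nil_append, append_nil, ← hr, ← append_assoc, ht]⟩
  rw [h t [], append_nil] at h1
  have h2 := ((infix_append_cases_left h1).resolve_left hv).length_le
  have h3 := congrArg length ht
  simp only [length_append] at h2 h3
  omega

theorem IdealEquiv.overlap_eq_left {w u v : List A} (h : IdealEquiv w u v)
    (hv : ¬ w <:+: v) : overlap u w = overlap v w := by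
  have hu : ¬ w <:+: u := fun h' => hv (h.infix_iff.mp h')
  have h1 := h.length_overlap_le hv
  have h2 := h.symm.length_overlap_le hu
  exact (suffix_of_suffix_length_le (overlap_suffix u w) (overlap_suffix v w) h1).eq_of_length
    (le_antisymm h1 h2)

theorem IdealEquiv.overlap_eq_right {w u v : List A} (h : IdealEquiv w u v)
    (hv : ¬ w <:+: v) : overlap w u = overlap w v := by
  have := h.reverse.overlap_eq_left (fun h' => hv (reverse_infix.mp h'))
  rw [overlap_reverse, overlap_reverse] at this
  exact reverse_injective this

theorem IdealEquiv.length_le_of_isInnerFactor {w u v : List A} (h : IdealEquiv w u v)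
    (hu : IsInnerFactor u w) : u.length ≤ v.length := by
  obtain ⟨-, t, s, -, -, hw⟩ := hu
  have h1 : w <:+: t ++ u ++ s := by rw [← hw]
  have h2 := ((h t s).mp h1).length_le
  rw [hw] at h2
  simp only [length_append] at h2
  omega

theorem IsInnerFactor.length_lt {w u : List A} (h : IsInnerFactor u w) :
    u.length + 2 ≤ w.length := by
  obtain ⟨-, t, s, ht, hs, rfl⟩ := h
  have := length_pos_iff.mpr ht
  have := length_pos_iff.mpr hs
  simp only [length_append]
  omega

theorem IsInnerFactor.not_infix {w u : List A} (h : IsInnerFactor u w) : ¬ w <:+: u := by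
  intro h'
  have := h'.length_le
  have := h.length_lt
  omega

/-- Let `w = t u s`. If `v` were not inner, `w` would fit into `t` or `s` together with one overlap.
The overlaps of `v` are those of `u`, of length at most `|u|`, so the other nonempty side is missing
and there is no room. -/
theorem IdealEquiv.isInnerFactor {w u v : List A} (h : IdealEquiv w u v)
    (hv0 : v ≠ []) (hu : IsInnerFactor u w) : IsInnerFactor v w := by
  by_contra hv
  have hwv : ¬ w <:+: v := fun h' => hu.not_infix (h.infix_iff.mpr h')
  have hl := h.overlap_eq_left hwv
  have hr := h.overlap_eq_right hwv
  have h1 := (overlap_prefix u w).length_le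
  have h2 := (overlap_suffix w u).length_le
  obtain ⟨-, t, s, ht, hs, hw⟩ := hu
  have h3 : w <:+: t ++ v ++ s := by rw [← h t s, ← hw]
  rw [infix_append_append_iff hwv (fun h' => hv ⟨hv0, h'⟩), ← hl, ← hr] at h3
  have := length_pos_iff.mpr ht
  have := length_pos_iff.mpr hs
  have h4 := congrArg length hw
  simp only [length_append] at h4
  rcases h3 with h3 | h3
  all_goals
    have := h3.length_le
    simp only [length_append] at this
    omega

/-- The lengths agree, so the occurrence of `w = t u s` in `t v s` is the whole word. -/
theorem IdealEquiv.eq_of_isInnerFactor {w u v : List A} (h : IdealEquiv w u v)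
    (hu : IsInnerFactor u w) (hv : IsInnerFactor v w) : u = v := by
  have h1 := h.length_le_of_isInnerFactor hu
  have h2 := h.symm.length_le_of_isInnerFactor hv
  obtain ⟨-, t, s, -, -, hw⟩ := hu
  have h3 : w <:+: t ++ v ++ s := by rw [← h t s, ← hw]
  have h4 : w = t ++ v ++ s := by
    apply h3.eq_of_length
    rw [hw]
    simp only [length_append]
    omega
  rw [hw, append_assoc, append_assoc] at h4
  exact append_cancel_right (append_cancel_left h4)

open Classical in
/-- A complete invariant of the syntactic class of a nonempty word. -/
noncomputable def classInvariant (w u : List A) : Option (List A ⊕ List A × List A) :=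
  if w <:+: u then none
  else if IsInnerFactor u w then some (.inl u)
  else some (.inr (overlap u w, overlap w u))

theorem classInvariant_eq_iff {w u v : List A} (hu0 : u ≠ []) (hv0 : v ≠ []) :
    classInvariant w u = classInvariant w v ↔ IdealEquiv w u v := by
  constructor
  · intro h x y
    unfold classInvariant at h
    by_cases h1 : w <:+: u <;> by_cases h2 : w <:+: v
    · exact iff_of_true (h1.trans ⟨x, y, rfl⟩) (h2.trans ⟨x, y, rfl⟩)
    · rw [if_pos h1, if_neg h2] at h
      split_ifs at h
    · rw [if_neg h1, if_pos h2] at h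
      split_ifs at h
    rw [if_neg h1, if_neg h2] at h
    by_cases h3 : IsInnerFactor u w <;> by_cases h4 : IsInnerFactor v w <;>
      simp only [h3, h4, if_true, if_false, Option.some.injEq, Sum.inl.injEq, Sum.inr.injEq,
        Prod.mk.injEq, reduceCtorEq] at h
    · rw [h]
    · rw [infix_append_append_iff h1 (fun h' => h3 ⟨hu0, h'⟩),
        infix_append_append_iff h2 (fun h' => h4 ⟨hv0, h'⟩), h.1, h.2]
  · intro h
    have h1 := h.infix_iff
    have h2 : IsInnerFactor u w ↔ IsInnerFactor v w :=
      ⟨h.isInnerFactor hv0, h.symm.isInnerFactor hu0⟩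
    unfold classInvariant
    by_cases hv : w <:+: v
    · rw [if_pos hv, if_pos (h1.mpr hv)]
    rw [if_neg hv, if_neg (fun h' => hv (h1.mp h'))]
    by_cases hi : IsInnerFactor v w
    · rw [if_pos hi, if_pos (h2.mpr hi), h.eq_of_isInnerFactor (h2.mpr hi) hi]
    · rw [if_neg hi, if_neg (fun h' => hi (h2.mp h')), h.overlap_eq_left hv,
        h.overlap_eq_right hv]

/-- The pairs of overlaps with `w` of the nonempty words that neither contain `w`
nor are inner factors of `w`. -/
def overlapPairs (w : List A) : Set (List A × List A) :=
  {q | ∃ u : List A, u ≠ [] ∧ ¬ w <:+: u ∧ ¬ IsInnerFactor u w ∧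
    overlap u w = q.1 ∧ overlap w u = q.2}

theorem syntacticCon_iff {w : List A} (u v : FreeMonoid A) :
    syntacticCon (principalIdealLanguage w) u v ↔ IdealEquiv w u.toList v.toList := by
  have key : ∀ z : List A, z ∈ principalIdealLanguage w ↔ w <:+: z := fun z =>
    ⟨fun ⟨x, y, h⟩ => ⟨x, y, h.symm⟩, fun ⟨x, y, h⟩ => ⟨x, y, h.symm⟩⟩
  change (∀ x y : FreeMonoid A, _ ↔ _) ↔ _
  simp only [key]
  rfl

theorem syntacticComplexity_eq_ncard (w : List A) :
    syntacticComplexity (principalIdealLanguage w) =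
      (classInvariant w '' {u | u ≠ []}).ncard := by
  let f : nonemptyWords A → Option (List A ⊕ List A × List A) :=
    fun u => classInvariant w u.1.toList
  have hf : ∀ u v : nonemptyWords A,
      (Con.comap (MulMemClass.subtype (nonemptyWords A)) (fun u v => map_mul _ u v)
        (syntacticCon (principalIdealLanguage w))) u v ↔ f u = f v := by
    intro u v
    rw [Con.comap_rel]
    exact (syntacticCon_iff _ _).trans (classInvariant_eq_iff u.2 v.2).symm
  have hr : classInvariant w '' {u | u ≠ []} = Set.range f := by
    ext q
    constructor
    · rintro ⟨u, hu, rfl⟩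
      exact ⟨⟨FreeMonoid.ofList u, hu⟩, rfl⟩
    · rintro ⟨u, rfl⟩
      exact ⟨u.1.toList, u.2, rfl⟩
  rw [hr, ← Nat.card_coe_set_eq]
  refine Nat.card_congr (Equiv.ofBijective
    (Quotient.lift (fun u => (⟨f u, u, rfl⟩ : Set.range f))
      (fun u v h => Subtype.ext ((hf u v).mp h))) ⟨?_, ?_⟩)
  · intro p q
    refine Quotient.inductionOn₂ p q fun u v h => Quotient.sound ?_
    exact (hf u v).mpr (congrArg Subtype.val h)
  · rintro ⟨_, u, rfl⟩
    exact ⟨Quotient.mk _ u, rfl⟩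

theorem image_classInvariant [Nonempty A] (w : List A) :
    classInvariant w '' {u | u ≠ []} =
      insert none (some '' (Sum.inl '' {u | IsInnerFactor u w} ∪ Sum.inr '' overlapPairs w)) := by
  ext q
  constructor
  · rintro ⟨u, hu, rfl⟩
    unfold classInvariant
    split_ifs with h1 h2
    · exact .inl rfl
    · exact .inr ⟨_, .inl ⟨u, h2, rfl⟩, rfl⟩
    · exact .inr ⟨_, .inr ⟨_, ⟨u, hu, h1, h2, rfl, rfl⟩, rfl⟩, rfl⟩
  · rintro (rfl | ⟨_, ⟨u, hu, rfl⟩ | ⟨⟨s, p⟩, ⟨u, hu, h1, h2, rfl, rfl⟩, rfl⟩, rfl⟩)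
    · obtain ⟨c⟩ := ‹Nonempty A›
      -- The extra letter keeps the witness nonempty when `w` is empty.
      exact ⟨c :: w, cons_ne_nil _ _, if_pos ⟨[c], [], by simp⟩⟩
    · exact ⟨u, hu.1, (if_neg hu.not_infix).trans (if_pos hu)⟩
    · exact ⟨u, hu, (if_neg h1).trans (if_neg h2)⟩

/-! ### Proper prefixes and suffixes -/

theorem properSuffixes_eq (w : List A) : {s | s <:+ w ∧ s.length < w.length} =
    (fun k => w.drop (w.length - k)) '' (Finset.range w.length : Set ℕ) := by
  ext s
  simp only [Set.mem_ofPred_eq, Set.mem_image, Finset.coe_range, Set.mem_Iio]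
  constructor
  · rintro ⟨h, hl⟩
    exact ⟨s.length, hl, (suffix_iff_eq_drop.mp h).symm⟩
  · rintro ⟨k, hk, rfl⟩
    exact ⟨drop_suffix _ _, by simp; omega⟩

theorem properPrefixes_eq (w : List A) : {s | s <+: w ∧ s.length < w.length} =
    (fun k => w.take k) '' (Finset.range w.length : Set ℕ) := by
  ext s
  simp only [Set.mem_ofPred_eq, Set.mem_image, Finset.coe_range, Set.mem_Iio]
  constructor
  · rintro ⟨h, hl⟩
    exact ⟨s.length, hl, (prefix_iff_eq_take.mp h).symm⟩
  · rintro ⟨k, hk, rfl⟩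
    exact ⟨take_prefix _ _, by simp; omega⟩

theorem ncard_properSuffixes (w : List A) :
    {s | s <:+ w ∧ s.length < w.length}.ncard = w.length := by
  rw [properSuffixes_eq, Set.InjOn.ncard_image, Set.ncard_coe_finset, Finset.card_range]
  intro i hi j hj h
  have := congrArg length h
  simp only [Finset.coe_range, Set.mem_Iio, length_drop] at hi hj this
  omega

theorem ncard_properPrefixes (w : List A) :
    {s | s <+: w ∧ s.length < w.length}.ncard = w.length := by
  rw [properPrefixes_eq, Set.InjOn.ncard_image, Set.ncard_coe_finset, Finset.card_range]
  intro i hi j hj h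
  have := congrArg length h
  simp only [Finset.coe_range, Set.mem_Iio, length_take] at hi hj this
  omega

/-- The pairs of a proper suffix and a proper prefix of `w`. -/
def properPairs (w : List A) : Set (List A × List A) :=
  {s | s <:+ w ∧ s.length < w.length} ×ˢ {p | p <+: w ∧ p.length < w.length}

theorem finite_properPairs (w : List A) : (properPairs w).Finite := by
  unfold properPairs
  rw [properSuffixes_eq, properPrefixes_eq]
  exact ((Finset.finite_toSet _).image _).prod ((Finset.finite_toSet _).image _)

theorem ncard_properPairs (w : List A) : (properPairs w).ncard = w.length ^ 2 := by
  rw [properPairs, Set.ncard_prod, ncard_properSuffixes, ncard_properPrefixes, sq]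

theorem overlapPairs_subset (w : List A) : overlapPairs w ⊆ properPairs w := by
  rintro ⟨s, p⟩ ⟨u, -, hw, -, hs, hp⟩
  simp only at hs hp
  subst hs hp
  refine ⟨⟨overlap_suffix u w, ?_⟩, overlap_prefix w u, ?_⟩
  · by_contra h
    exact hw ((overlap_suffix u w).eq_of_length_le (not_lt.mp h) ▸
      (overlap_prefix u w).isInfix)
  · by_contra h
    exact hw ((overlap_prefix w u).eq_of_length_le (not_lt.mp h) ▸
      (overlap_suffix w u).isInfix)

theorem syntacticComplexity_eq [Nonempty A] (w : List A) :
    syntacticComplexity (principalIdealLanguage w) =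
      1 + numInnerFactors w + (overlapPairs w).ncard := by
  have hfi := finite_innerFactors w
  have hfo := (finite_properPairs w).subset (overlapPairs_subset w)
  have hf := (hfi.image (Sum.inl (β := List A × List A))).union (hfo.image (Sum.inr (α := List A)))
  rw [syntacticComplexity_eq_ncard, image_classInvariant,
    Set.ncard_insert_of_notMem (by simp) (hf.image _),
    Set.ncard_image_of_injective _ (Option.some_injective _),
    Set.ncard_union_eq ?_ (hfi.image _) (hfo.image _),
    Set.ncard_image_of_injective _ Sum.inl_injective,
    Set.ncard_image_of_injective _ Sum.inr_injective, numInnerFactors]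
  · omega
  · rw [Set.disjoint_left]
    rintro _ ⟨u, -, rfl⟩ ⟨v, -, h⟩
    simp at h

/-! ### Words realizing prescribed overlaps -/

/-- A longer overlap would end inside the block of `c`, which is at least as long as `w`; but `w`
does not end in `c`. -/
theorem overlap_append_replicate {w s r : List A} {c : A} {m : ℕ} (hs : s <:+ w)
    (hc : ¬ [c] <:+ w) (hm : w.length ≤ m) : overlap (s ++ (replicate m c ++ r)) w = s := by
  refine overlap_eq (prefix_append _ _) hs fun t ht htw => ?_
  by_contra! hlt
  obtain ⟨t', rfl⟩ := prefix_of_prefix_length_le (prefix_append s _) ht hlt.le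
  have h1 : t' <+: replicate m c ++ r := (prefix_append_right_inj s).mp ht
  have hl := htw.length_le
  simp only [length_append] at hl hlt
  have h2 : t' <+: replicate m c :=
    prefix_of_prefix_length_le h1 (prefix_append _ _) (by simp; omega)
  have h3 : t' = replicate t'.length c :=
    eq_replicate_iff.mpr ⟨rfl, fun b hb => eq_of_mem_replicate (h2.subset hb)⟩
  obtain ⟨k, hk⟩ : ∃ k, t'.length = k + 1 := ⟨t'.length - 1, by omega⟩
  rw [hk, replicate_succ'] at h3
  apply hc
  refine IsSuffix.trans ?_ htw
  rw [h3, ← append_assoc]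
  exact suffix_append _ _

theorem overlap_replicate_append {w p r : List A} {d : A} {m : ℕ} (hp : p <+: w)
    (hd : ¬ [d] <+: w) (hm : w.length ≤ m) : overlap w (r ++ replicate m d ++ p) = p := by
  have := overlap_append_replicate (w := w.reverse) (s := p.reverse) (r := r.reverse) (c := d)
    (m := m) (reverse_suffix.mpr hp) (fun h => hd (by rwa [← reverse_suffix])) (by simpa)
  rw [← reverse_injective.eq_iff, ← overlap_reverse]
  simpa using this

/-- The witness is `s z p`. The blocks at the two ends of `z` (which may coincide) stop the overlaps
at `s` and `p`, and `z` is too long to lie strictly inside `w`. -/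
theorem exists_word_of_overlaps {w z z₁ z₂ s p : List A} {c d : A}
    (hz₁ : z = replicate w.length c ++ z₁) (hz₂ : z = z₂ ++ replicate w.length d)
    (hw0 : w ≠ []) (hc : ¬ [c] <:+ w) (hd : ¬ [d] <+: w) (hwz : ¬ w <:+: z)
    (hs : s <:+ w) (hsl : s.length < w.length) (hp : p <+: w) (hpl : p.length < w.length) :
    (s, p) ∈ overlapPairs w := by
  have hlz : w.length ≤ z.length := by simp [hz₁]
  have hpos := length_pos_iff.mpr hw0
  refine ⟨s ++ z ++ p, ?_, ?_, ?_, ?_, ?_⟩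
  · rw [← length_pos_iff]
    simp only [length_append]
    omega
  · intro h
    rcases infix_append_append_cases h with h | h | ⟨t, r, ht, hr, h⟩
    · rcases infix_append_cases_left h with h | h
      · exact hwz h
      -- The case of an empty suffix: `z` itself has empty overlap, so `w` would have to fit into
      -- `s`.
      · have h1 := overlap_append_replicate (r := z₁) (nil_suffix (l := w)) hc le_rfl
        rw [nil_append, ← hz₁] at h1
        rw [h1, append_nil] at h
        exact absurd h.length_le (by omega)
    · rcases infix_append_cases_right h with h | h
      · exact hwz h
      · have h1 := overlap_replicate_append (r := z₂) (nil_prefix (l := w)) hd le_rfl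
        rw [append_nil, ← hz₂] at h1
        rw [h1, nil_append] at h
        exact absurd h.length_le (by omega)
    · have := length_pos_iff.mpr ht
      have h' := congrArg length h
      simp only [length_append] at h'
      omega
  · intro h
    have := h.length_lt
    simp only [length_append] at this
    omega
  · change overlap (s ++ z ++ p) w = s
    rw [hz₁, append_assoc, append_assoc]
    exact overlap_append_replicate hs hc le_rfl
  · change overlap w (s ++ z ++ p) = p
    rw [hz₂, ← append_assoc]
    exact overlap_replicate_append hp hd le_rfl

theorem replicate_append_infix {a b : A} {i j : ℕ} {w : List A}
    (h : w <:+: replicate i a ++ replicate j b) :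
    ∃ k l, w = replicate k a ++ replicate l b := by
  have hall : ∀ {m : ℕ} {x : A} {t : List A}, t <:+: replicate m x →
      t = replicate t.length x := fun h' =>
    eq_replicate_iff.mpr ⟨rfl, fun _ hx => eq_of_mem_replicate (h'.subset hx)⟩
  obtain ⟨α, β, h⟩ := h
  rw [append_assoc, append_eq_append_iff] at h
  rcases h with ⟨t, h1, h⟩ | ⟨t, rfl, h⟩
  · rw [append_eq_append_iff] at h
    rcases h with ⟨q, rfl, -⟩ | ⟨q, rfl, h2⟩
    · exact ⟨w.length, 0, by
        simpa using hall (m := i) (x := a) ⟨α, q, by rw [h1, append_assoc]⟩⟩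
    · refine ⟨t.length, q.length, ?_⟩
      rw [← hall (m := i) (x := a) (t := t) ⟨α, [], by simp [h1]⟩,
        ← hall (m := j) (x := b) (t := q) ⟨[], β, by simp [h2]⟩]
  · exact ⟨0, w.length, by
      simpa using hall (m := j) (x := b) (t := w) ⟨t, β, by rw [h, append_assoc]⟩⟩

/-- The first run of `a` is followed by a single `b` before the next `a`, and the second run of `a`
has length one. -/
theorem not_square_infix {a b : A} (hab : a ≠ b) (m k : ℕ) :
    ¬ [a, a, b, b] <:+: replicate m a ++ (b :: a :: replicate k b) := by
  induction m with
  | zero =>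
    intro h
    simp only [replicate_zero, nil_append, infix_cons_iff, cons_prefix_cons] at h
    rcases h with h | h | h
    · exact hab h.1
    · rcases k with _ | k
      · simp at h
      · simp only [replicate_succ, cons_prefix_cons] at h
        exact hab h.2.1
    · exact hab (eq_of_mem_replicate (h.subset (by simp : a ∈ _)))
  | succ m ih =>
    intro h
    rw [replicate_succ, cons_append, infix_cons_iff] at h
    rcases h with h | h
    · rcases m with _ | _ | m
      · simp [hab] at h
      · simp [replicate_succ, cons_prefix_cons, hab.symm] at h
      · simp [replicate_succ, cons_prefix_cons, hab.symm] at h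
    · exact ih h

/-- The separator `a^n b^n` works unless it contains `w`. In that case `w = a^k b^l`, and the
hypotheses force `k, l ≥ 2`; then `w` contains `aabb`, which `a^n b a b^n` avoids. -/
theorem overlapPairs_eq_of_ne {a b : A} (hab : a ≠ b) {w : List A}
    (ha : [a] <+: w) (hb : [b] <:+ w)
    (h1 : w ≠ replicate (w.length - 1) a ++ [b]) (h2 : w ≠ [a] ++ replicate (w.length - 1) b) :
    overlapPairs w = properPairs w := by
  have hw0 : w ≠ [] := by rintro rfl; simp at ha
  have hc : ¬ [a] <:+ w := fun h => by
    have := (suffix_of_suffix_length_le h hb le_rfl).eq_of_length rfl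
    simp [hab] at this
  have hd : ¬ [b] <+: w := fun h => by
    have := (prefix_of_prefix_length_le h ha le_rfl).eq_of_length rfl
    simp [hab.symm] at this
  refine (overlapPairs_subset w).antisymm ?_
  rintro ⟨s, p⟩ ⟨⟨hs, hsl⟩, hp, hpl⟩
  by_cases hw : w <:+: replicate w.length a ++ replicate w.length b
  · refine exists_word_of_overlaps (z := replicate w.length a ++ (b :: a :: replicate w.length b))
      (z₂ := replicate w.length a ++ [b, a]) rfl (by simp) hw0 hc hd ?_ hs hsl hp hpl
    intro h
    obtain ⟨k, l, hkl⟩ := replicate_append_infix hw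
    have hlen : w.length = k + l := by rw [hkl]; simp
    refine not_square_infix hab w.length w.length (IsInfix.trans ?_ h)
    rw [hlen] at h1 h2
    match k, l, hkl, h1, h2 with
    | 0, l, hkl, h1, h2 =>
      rw [hkl, replicate_zero, nil_append] at ha
      exact absurd (eq_of_mem_replicate (ha.subset (by simp))) hab
    | k, 0, hkl, h1, h2 =>
      rw [hkl, replicate_zero, append_nil] at hb
      exact absurd (eq_of_mem_replicate (hb.subset (by simp))) hab.symm
    | 1, l + 1, hkl, h1, h2 =>
      exact absurd (by rw [hkl, Nat.add_comm 1, Nat.add_sub_cancel, replicate_one]) h2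
    | k + 1, 1, hkl, h1, h2 =>
      exact absurd (by rw [hkl, Nat.add_sub_cancel, replicate_one]) h1
    | k + 2, l + 2, hkl, h1, h2 =>
      rw [hkl]
      exact ⟨replicate k a, replicate l b, by
        rw [replicate_add k 2, Nat.add_comm l 2, replicate_add 2 l]
        simp [show ∀ x : A, replicate 2 x = [x, x] from fun _ => rfl]⟩
  · exact exists_word_of_overlaps rfl rfl hw0 hc hd hw hs hsl hp hpl

/-- The separator `d^n` suffices: `w` contains `c`. -/
theorem overlapPairs_eq_of_same {c d : A} (hcd : c ≠ d) {w : List A}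
    (h1 : [c] <+: w) (h2 : [c] <:+ w) : overlapPairs w = properPairs w := by
  have hw0 : w ≠ [] := by rintro rfl; simp at h1
  refine (overlapPairs_subset w).antisymm ?_
  rintro ⟨s, p⟩ ⟨⟨hs, hsl⟩, hp, hpl⟩
  refine exists_word_of_overlaps (z := replicate w.length d) (z₁ := []) (z₂ := [])
    (c := d) (d := d) (by simp) (by simp) hw0 ?_ ?_ ?_ hs hsl hp hpl
  · intro h
    have := (suffix_of_suffix_length_le h h2 le_rfl).eq_of_length rfl
    simp [hcd.symm] at this
  · intro h
    have := (prefix_of_prefix_length_le h h1 le_rfl).eq_of_length rfl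
    simp [hcd.symm] at this
  · intro h
    exact hcd (eq_of_mem_replicate (h.subset (h1.subset (by simp))))

theorem overlapPairs_eq {a b : A} (hab : a ≠ b) (hA : ∀ x : A, x = a ∨ x = b)
    {w : List A} (hw : w ∉ exceptionalWords a b w.length) : overlapPairs w = properPairs w := by
  rcases eq_or_ne w [] with rfl | hw0
  -- The empty word has no proper suffix, so both sets are empty.
  · refine (overlapPairs_subset _).antisymm ?_
    rintro ⟨s, p⟩ ⟨⟨-, h⟩, -⟩
    simp at h
  simp only [exceptionalWords, Set.mem_insert_iff, Set.mem_singleton_iff, not_or] at hw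
  obtain ⟨e1, e2, e3, e4⟩ := hw
  have hx : [w.head hw0] <+: w := ⟨w.tail, by simp⟩
  have hy : [w.getLast hw0] <:+ w := ⟨w.dropLast, dropLast_append_getLast hw0⟩
  rcases hA (w.head hw0) with h1 | h1 <;> rcases hA (w.getLast hw0) with h2 | h2 <;>
    rw [h1] at hx <;> rw [h2] at hy
  · exact overlapPairs_eq_of_same hab hx hy
  · exact overlapPairs_eq_of_ne hab hx hy e1 e2
  · exact overlapPairs_eq_of_ne hab.symm hx hy e4 e3
  · exact overlapPairs_eq_of_same hab.symm hx hy

/-! ### Reversal -/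

theorem isInnerFactor_reverse {u w : List A} (h : IsInnerFactor u w) :
    IsInnerFactor u.reverse w.reverse := by
  obtain ⟨hu, t, s, ht, hs, rfl⟩ := h
  exact ⟨by simpa, s.reverse, t.reverse, by simpa, by simpa, by simp⟩

theorem isInnerFactor_reverse_iff {u w : List A} :
    IsInnerFactor u w.reverse ↔ IsInnerFactor u.reverse w :=
  ⟨fun h => by simpa using isInnerFactor_reverse h,
    fun h => by simpa using isInnerFactor_reverse h⟩

theorem numInnerFactors_reverse (w : List A) :
    numInnerFactors w.reverse = numInnerFactors w := by
  have : {u : List A | IsInnerFactor u w.reverse} = reverse '' {u | IsInnerFactor u w} := by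
    ext u
    rw [Set.mem_ofPred_eq, isInnerFactor_reverse_iff]
    exact ⟨fun h => ⟨_, h, reverse_reverse u⟩, by rintro ⟨v, hv, rfl⟩; simpa using hv⟩
  rw [numInnerFactors, numInnerFactors, this, Set.ncard_image_of_injective _ reverse_injective]

theorem mem_overlapPairs_reverse {w s p : List A} (h : (s, p) ∈ overlapPairs w) :
    (p.reverse, s.reverse) ∈ overlapPairs w.reverse := by
  obtain ⟨u, hu, hw, hi, hs, hp⟩ := h
  simp only at hs hp
  refine ⟨u.reverse, by simpa, fun h => hw (reverse_infix.mp h), ?_, ?_, ?_⟩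
  · rwa [isInnerFactor_reverse_iff, reverse_reverse]
  · simp only [overlap_reverse, hp]
  · simp only [overlap_reverse, hs]

theorem ncard_overlapPairs_reverse (w : List A) :
    (overlapPairs w.reverse).ncard = (overlapPairs w).ncard := by
  let f : List A × List A → List A × List A := fun q => (q.2.reverse, q.1.reverse)
  have hf : Function.Injective f := fun q r h => by
    simp only [f, Prod.mk.injEq, reverse_inj] at h
    exact Prod.ext h.2 h.1
  have : overlapPairs w.reverse = f '' overlapPairs w := by
    ext ⟨s, p⟩
    constructor
    · intro h
      exact ⟨_, by simpa using mem_overlapPairs_reverse h, by simp [f]⟩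
    · rintro ⟨⟨s, p⟩, h, hq⟩
      rw [← hq]
      exact mem_overlapPairs_reverse h
  rw [this, Set.ncard_image_of_injective _ hf]

theorem syntacticComplexity_reverse [Nonempty A] (w : List A) :
    syntacticComplexity (principalIdealLanguage w.reverse) =
      syntacticComplexity (principalIdealLanguage w) := by
  rw [syntacticComplexity_eq, syntacticComplexity_eq, numInnerFactors_reverse,
    ncard_overlapPairs_reverse]

/-! ### The exceptional words -/

theorem isInnerFactor_replicate_append_iff {a b : A} {m : ℕ} {u : List A} :
    IsInnerFactor u (replicate m a ++ [b]) ↔ ∃ k, k + 1 < m ∧ u = replicate (k + 1) a := by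
  constructor
  · rintro ⟨hu, t, s, ht, hs, h⟩
    obtain ⟨r, c, rfl⟩ := eq_nil_or_concat s |>.resolve_left hs
    rw [concat_eq_append, ← append_assoc] at h
    have h' := append_inj_left' h rfl
    have hl := congrArg length h'
    have := length_pos_iff.mpr ht
    have := length_pos_iff.mpr hu
    simp only [length_append, length_replicate] at hl
    refine ⟨u.length - 1, by omega, ?_⟩
    rw [Nat.sub_add_cancel this]
    refine eq_replicate_iff.mpr ⟨rfl, fun x hx => eq_of_mem_replicate (n := m) ?_⟩
    rw [h']
    simp [hx]
  · rintro ⟨k, hk, rfl⟩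
    refine ⟨by simp, replicate (m - (k + 1)) a, [b], ?_, by simp, ?_⟩
    · rw [← length_pos_iff, length_replicate]
      omega
    · rw [← replicate_add, Nat.sub_add_cancel hk.le]

theorem numInnerFactors_replicate_append (a b : A) (m : ℕ) :
    numInnerFactors (replicate m a ++ [b]) = m - 1 := by
  have : {u : List A | IsInnerFactor u (replicate m a ++ [b])} =
      (fun k => replicate (k + 1) a) '' (Finset.range (m - 1) : Set ℕ) := by
    ext u
    rw [Set.mem_ofPred_eq, isInnerFactor_replicate_append_iff]
    simp only [Set.mem_image, Finset.coe_range, Set.mem_Iio]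
    exact ⟨fun ⟨k, hk, h⟩ => ⟨k, by omega, h.symm⟩, fun ⟨k, hk, h⟩ => ⟨k, by omega, h.symm⟩⟩
  rw [numInnerFactors, this, Set.InjOn.ncard_image, Set.ncard_coe_finset, Finset.card_range]
  intro i _ j _ h
  simpa using congrArg length h

theorem exists_eq_replicate_or {a b : A} (hA : ∀ x : A, x = a ∨ x = b) (u : List A) :
    ∃ k r, u = replicate k a ∨ u = replicate k a ++ b :: r := by
  induction u with
  | nil => exact ⟨0, [], .inl rfl⟩
  | cons x u ih =>
    obtain ⟨k, r, h⟩ := ih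
    rcases hA x with rfl | rfl
    · exact ⟨k + 1, r, by simpa [replicate_succ] using h⟩
    · exact ⟨0, u, .inr rfl⟩

theorem replicate_append_suffix {a b : A} {i m : ℕ} (h : i ≤ m) :
    replicate i a ++ [b] <:+ replicate m a ++ [b] :=
  ⟨replicate (m - i) a, by rw [← append_assoc, ← replicate_add, Nat.sub_add_cancel h]⟩

/-- A word `a^j b r` has nonempty left overlap if `j ≤ m` and contains `w` if `j > m`. A power `a^j`
is an inner factor if `0 < j < m` and has right overlap at least `a^m` if `j ≥ m`. -/
theorem nil_replicate_notMem {a b : A} (hA : ∀ x : A, x = a ∨ x = b) {m k : ℕ} (hk : k < m) :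
    ([], replicate k a) ∉ overlapPairs (replicate m a ++ [b]) := by
  rintro ⟨u, hu, hw, hi, hs, hp⟩
  simp only at hs hp
  obtain ⟨j, r, rfl | rfl⟩ := exists_eq_replicate_or hA u
  · rcases lt_or_ge j m with hj | hj
    · obtain ⟨i, rfl⟩ : ∃ i, j = i + 1 := ⟨j - 1, by
        rcases j with _ | j
        · simp at hu
        · simp⟩
      exact hi (isInnerFactor_replicate_append_iff.mpr ⟨i, hj, rfl⟩)
    · have := length_le_length_overlap (u := replicate m a ++ [b]) (v := replicate j a)
        (t := replicate m a) (prefix_append _ _)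
        ⟨replicate (j - m) a, by rw [← replicate_add, Nat.sub_add_cancel hj]⟩
      rw [hp] at this
      simp only [length_replicate] at this
      omega
  · rcases le_or_gt j m with hj | hj
    · have := length_le_length_overlap (u := replicate j a ++ b :: r)
        (v := replicate m a ++ [b]) (t := replicate j a ++ [b]) ⟨r, by simp⟩
        (replicate_append_suffix hj)
      rw [hs] at this
      simp at this
    · refine hw ⟨replicate (j - m) a, r, ?_⟩
      rw [← append_assoc, ← replicate_add, Nat.sub_add_cancel hj.le, append_assoc,
        singleton_append]

theorem nil_replicate_mem {a b : A} (hab : a ≠ b) {m : ℕ} (hm : 1 ≤ m) :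
    ([], replicate m a) ∈ overlapPairs (replicate m a ++ [b]) := by
  refine ⟨replicate m a, ?_, ?_, ?_, ?_, ?_⟩
  · rw [← length_pos_iff, length_replicate]
    omega
  · intro h
    simpa using h.length_le
  · intro h
    simpa using h.length_lt
  · refine overlap_eq nil_prefix nil_suffix fun t ht hs => ?_
    by_contra! h
    obtain ⟨r, c, rfl⟩ := eq_nil_or_concat t |>.resolve_left (length_pos_iff.mp h)
    rw [concat_eq_append] at ht hs
    have hc : c = a := eq_of_mem_replicate (ht.subset (by simp))
    have h1 : [c] <:+ replicate m a ++ [b] := (suffix_append r [c]).trans hs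
    have := (suffix_of_suffix_length_le h1 (suffix_append _ [b]) le_rfl).eq_of_length rfl
    simp [hc, hab] at this
  · exact overlap_eq (prefix_append _ _) suffix_rfl fun t _ hs => hs.length_le

/-- A separator `a^n ⋯ b^n` would contain `a^m b`, so the block of `a` is dropped: the witness is
`a^i b b^n a^k`. The left overlap still stops at `a^i b`, because in `w` nothing follows `b`. -/
theorem replicate_append_mem {a b : A} (hab : a ≠ b) {m i k : ℕ} (hi : i < m) (hk : k ≤ m) :
    (replicate i a ++ [b], replicate k a) ∈ overlapPairs (replicate m a ++ [b]) := by
  set w := replicate m a ++ [b] with hw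
  have hwl : w.length = m + 1 := by simp [hw]
  have hd : ¬ [b] <+: w := by
    obtain ⟨l, rfl⟩ : ∃ l, m = l + 1 := ⟨m - 1, by omega⟩
    rw [hw, replicate_succ]
    simp [hab.symm]
  have hpw : replicate k a <+: w :=
    ⟨replicate (m - k) a ++ [b], by rw [← append_assoc, ← replicate_add, Nat.add_sub_cancel' hk]⟩
  have hright : ∀ r, overlap w (r ++ replicate w.length b ++ replicate k a) = replicate k a :=
    fun r => overlap_replicate_append hpw hd le_rfl
  -- There are only `i < m` letters `a` available.
  have hcount : ∀ j : ℕ, ¬ w <:+: replicate i a ++ replicate j b := by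
    classical
    intro j h
    have := h.sublist.count_le a
    simp [hw, count_append, count_replicate, hab.symm] at this
    omega
  refine ⟨(replicate i a ++ [b]) ++ replicate w.length b ++ replicate k a, by simp, ?_, ?_, ?_,
    hright _⟩
  · intro h
    rcases infix_append_append_cases h with h | h | ⟨t, r, ht, hr, h⟩
    · refine hcount (1 + w.length) ?_
      rw [replicate_add, ← append_assoc]
      exact h
    · rcases infix_append_cases_right h with h | h
      · exact hab (eq_of_mem_replicate (h.subset (by simp [hw]; omega)))
      · have h0 := overlap_replicate_append (r := []) (nil_prefix (l := w)) hd le_rfl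
        rw [nil_append, append_nil] at h0
        rw [h0, nil_append] at h
        have := h.length_le
        simp only [length_replicate] at this
        omega
    · have := length_pos_iff.mpr ht
      have h' := congrArg length h
      simp only [length_append, length_replicate] at h'
      omega
  · intro h
    have := h.length_lt
    simp only [length_append, length_replicate] at this
    omega
  · refine overlap_eq ⟨replicate w.length b ++ replicate k a, by simp⟩
      (replicate_append_suffix hi.le) fun t ht hs => ?_
    by_contra! hlt
    obtain ⟨t', rfl⟩ := prefix_of_prefix_length_le
      (⟨replicate w.length b ++ replicate k a, by simp⟩ : replicate i a ++ [b] <+: _) ht hlt.le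
    obtain ⟨r, c, rfl⟩ := eq_nil_or_concat t' |>.resolve_left (by rintro rfl; simp at hlt)
    obtain ⟨q, hq⟩ := hs
    rw [hw, concat_eq_append, ← append_assoc, ← append_assoc] at hq
    have h' := append_inj_left' hq rfl
    have : b ∈ replicate m a := by
      rw [← h']
      simp
    exact hab (eq_of_mem_replicate this).symm

theorem mem_properPairs_replicate_append_iff {a b : A} {m : ℕ} {s p : List A} :
    (s, p) ∈ properPairs (replicate m a ++ [b]) ↔
      (s = [] ∨ ∃ i < m, s = replicate i a ++ [b]) ∧ ∃ k ≤ m, p = replicate k a := by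
  refine and_congr ⟨?_, ?_⟩ ⟨?_, ?_⟩
  · rintro ⟨⟨q, hq⟩, hl⟩
    simp only [length_append, length_replicate, length_singleton] at hl
    rcases eq_nil_or_concat s with rfl | ⟨r, c, rfl⟩
    · exact .inl rfl
    · right
      rw [concat_eq_append, ← append_assoc] at hq
      obtain ⟨h1, h2⟩ := append_inj' hq rfl
      refine ⟨r.length, by simpa using hl, ?_⟩
      rw [concat_eq_append, h2, ← eq_replicate_iff.mpr
        ⟨rfl, fun x hx => eq_of_mem_replicate (n := m) (h1 ▸ mem_append_right q hx)⟩]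
  · rintro (rfl | ⟨i, hi, rfl⟩)
    · exact ⟨nil_suffix, by simp⟩
    · exact ⟨replicate_append_suffix hi.le, by simpa⟩
  · rintro ⟨hp, hl⟩
    simp only [length_append, length_replicate, length_singleton] at hl
    have hp' : p <+: replicate m a :=
      prefix_of_prefix_length_le hp (prefix_append _ _) (by simp; omega)
    exact ⟨p.length, by omega,
      eq_replicate_iff.mpr ⟨rfl, fun x hx => eq_of_mem_replicate (hp'.subset hx)⟩⟩
  · rintro ⟨k, hk, rfl⟩
    refine ⟨⟨replicate (m - k) a ++ [b], ?_⟩, by simp; omega⟩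
    rw [← append_assoc, ← replicate_add, Nat.add_sub_cancel' hk]

theorem ncard_overlapPairs_replicate_append {a b : A} (hab : a ≠ b)
    (hA : ∀ x : A, x = a ∨ x = b) {m : ℕ} (hm : 1 ≤ m) :
    (overlapPairs (replicate m a ++ [b])).ncard + m = (m + 1) ^ 2 := by
  set w := replicate m a ++ [b] with hw
  have h : properPairs w \ (fun k => (([] : List A), replicate k a)) '' (Finset.range m : Set ℕ) =
      overlapPairs w := by
    ext ⟨s, p⟩
    constructor
    · rintro ⟨h, h'⟩
      obtain ⟨rfl | ⟨i, hi, rfl⟩, k, hk, rfl⟩ := mem_properPairs_replicate_append_iff.mp h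
      · obtain rfl : k = m := by
          by_contra hne
          exact h' ⟨k, by simp; omega, rfl⟩
        exact nil_replicate_mem hab hm
      · exact replicate_append_mem hab hi hk
    · intro h
      refine ⟨overlapPairs_subset w h, ?_⟩
      rintro ⟨k, hk, h'⟩
      rw [← h'] at h
      exact nil_replicate_notMem hA (by simpa using hk) h
  have hsub : (fun k => (([] : List A), replicate k a)) '' (Finset.range m : Set ℕ) ⊆
      properPairs w := by
    rintro _ ⟨k, hk, rfl⟩
    simp only [Finset.coe_range, Set.mem_Iio] at hk
    exact mem_properPairs_replicate_append_iff.mpr ⟨.inl rfl, k, hk.le, rfl⟩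
  have hcard : ((fun k => (([] : List A), replicate k a)) '' (Finset.range m : Set ℕ)).ncard =
      m := by
    rw [Set.InjOn.ncard_image, Set.ncard_coe_finset, Finset.card_range]
    intro i _ j _ h
    simpa using congrArg (fun q => q.2.length) h
  have := Set.ncard_sdiff_add_ncard_of_subset hsub (finite_properPairs w)
  rw [h, hcard, ncard_properPairs] at this
  simpa [hw] using this

theorem syntacticComplexity_replicate_append {a b : A} (hab : a ≠ b)
    (hA : ∀ x : A, x = a ∨ x = b) {m : ℕ} (hm : 1 ≤ m) :
    syntacticComplexity (principalIdealLanguage (replicate m a ++ [b])) = (m + 1) ^ 2 := by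
  have : Nonempty A := ⟨a⟩
  have := ncard_overlapPairs_replicate_append hab hA hm
  rw [syntacticComplexity_eq, numInnerFactors_replicate_append]
  -- The m missing pairs cancel 1 + (m - 1), the class of words containing `w` together with the
  -- inner factors.
  omega

theorem syntacticComplexity_append_replicate {a b : A} (hab : a ≠ b)
    (hA : ∀ x : A, x = a ∨ x = b) {m : ℕ} (hm : 1 ≤ m) :
    syntacticComplexity (principalIdealLanguage ([b] ++ replicate m a)) = (m + 1) ^ 2 := by
  have : Nonempty A := ⟨a⟩
  rw [← syntacticComplexity_replicate_append hab hA hm, ← syntacticComplexity_reverse]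
  simp

end

/-- Here `A = {a, b}` is a two-letter alphabet. -/
theorem mainTheorem4 {A : Type*} (a b : A) (hab : a ≠ b) (hA : ∀ x : A, x = a ∨ x = b)
    (n : ℕ) (w : List A) (hw : w.length = n) :
    (w ∉ exceptionalWords a b n →
      syntacticComplexity (principalIdealLanguage w) = n ^ 2 + 1 + numInnerFactors w) ∧
    (2 ≤ n → w ∈ exceptionalWords a b n →
      syntacticComplexity (principalIdealLanguage w) = n ^ 2) := by
  have : Nonempty A := ⟨a⟩
  have hA' : ∀ x : A, x = b ∨ x = a := fun x => (hA x).symm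
  subst hw
  constructor
  · intro h
    rw [syntacticComplexity_eq, overlapPairs_eq hab hA h, ncard_properPairs]
    omega
  · intro hn h
    obtain ⟨m, hm⟩ : ∃ m, w.length = m + 1 := ⟨w.length - 1, by omega⟩
    rw [hm] at h hn ⊢
    have hm1 : 1 ≤ m := by omega
    simp only [exceptionalWords, Nat.add_sub_cancel, Set.mem_insert_iff,
      Set.mem_singleton_iff] at h
    rcases h with h | h | h | h <;> rw [h]
    · exact syntacticComplexity_replicate_append hab hA hm1
    · exact syntacticComplexity_append_replicate hab.symm hA' hm1
    · exact syntacticComplexity_append_replicate hab hA hm1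
    · exact syntacticComplexity_replicate_append hab.symm hA' hm1
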